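/- Let $\mathcal T$ be an essentially small triangulated category. A \emph{thick subcategory} of $\mathcal T$ is a full triangulated subcategory closed under direct summands; the thick subcategories form a lattice $\operatorname{Thick}\mathcal T$ under inclusion, with meet $\mathcal U\wedge\mathcal V$ the intersection and join $\mathcal U\vee\mathcal V$ the smallest thick subcategory containing $\mathcal U$ and $\mathcal V$. Two thick subcategories $\mathcal U,\mathcal V$ \emph{commute} if every morphism between an object of $\mathcal U$ and an object of $\mathcal V$ (in either direction) factors through an object of $\mathcal U\wedge\mathcal V$. A thick subcategory is \emph{central} if it commutes with every thick subcategory of $\mathcal T$, and $Z(\operatorname{Thick}\mathcal T)$ denotes the set of central thick subcategories, partially ordered by inclusion. A \emph{frame} is a complete lattice in which binary meets distribute over arbitrary joins, and a \emph{morphism of frames} is a map preserving finite meets (including the top element) and arbitrary joins. Let $\mathcal S\subseteq\mathcal T$ be any triangulated subcategory (not necessarily thick) and let $\mathcal T/\mathcal S$ be the Verdier quotient. Then the partially ordered sets $Z(\operatorname{Thick}\mathcal T)$, $Z(\operatorname{Thick}\mathcal S)$ and $Z(\operatorname{Thick}\mathcal T/\mathcal S)$ are frames, and the canonical functors $\mathcal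 S\to\mathcal T$ and $\mathcal T\to\mathcal T/\mathcal S$ induce well-defined morphisms of frames $$Z(\operatorname{Thick}\mathcal T)\longrightarrow Z(\operatorname{Thick}\mathcal S),\qquad \mathcal U\mapsto\mathcal U\wedge\mathcal S,$$ $$Z(\operatorname{Thick}\mathcal T)\longrightarrow Z(\operatorname{Thick}\mathcal T/\mathcal S),\qquad \mathcal U\mapsto(\mathcal U\vee\mathcal S)/\mathcal S.$$ Here $\mathcal U\wedge\mathcal S$ is the full subcategory of objects of $\mathcal S$ that lie in $\mathcal U$, the join $\mathcal U\vee\mathcal S$ is the smallest thick subcategory of $\mathcal T$ containing $\mathcal U$ and $\mathcal S$, and $(\mathcal U\vee\mathcal S)/\mathcal S$ is the full subcategory of $\mathcal T/\mathcal S$ formed by the objects isomorphic to the image of an object of $\mathcal U\vee\mathcal S$. -/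

import Mathlib

open CategoryTheory CategoryTheory.Limits

universe w v u

/-- The thick subcategories of a triangulated category: full triangulated subcategories
closed under direct summands (in a triangulated category: under retracts). In particular
they are closed under isomorphisms. -/
@[ext]
structure ThickSubcategory (T : Type u) [Category.{v} T] [HasZeroObject T] [HasShift T ℤ]
    [Preadditive T] [∀ n : ℤ, (shiftFunctor T n).Additive] [Pretriangulated T] where
  /-- The predicate "belongs to the subcategory" on the objects. -/
  prop : ObjectProperty T
  isTriangulated : prop.IsTriangulated
  isStableUnderRetracts : prop.IsStableUnderRetracts

namespace ThickSubcategory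

attribute [instance] isTriangulated isStableUnderRetracts

section Lattice

variable {T : Type u} [Category.{v} T] [HasZeroObject T] [HasShift T ℤ]
  [Preadditive T] [∀ n : ℤ, (shiftFunctor T n).Additive] [Pretriangulated T]

/-- Thick subcategories are ordered by inclusion. -/
instance : PartialOrder (ThickSubcategory T) :=
  PartialOrder.lift ThickSubcategory.prop (fun _ _ h => ThickSubcategory.ext h)

/-- The intersection of a family of thick subcategories. -/
instance : InfSet (ThickSubcategory T) where
  sInf s :=
    { prop := fun X => ∀ U ∈ s, U.prop X
      isStableUnderRetracts := ⟨fun r h U hU => U.prop.prop_of_retract r (h U hU)⟩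
      isTriangulated :=
        { exists_zero := ⟨_, isZero_zero T, fun U _ => U.prop.prop_zero⟩
          isStableUnderShiftBy := fun n =>
            ⟨fun X h U hU => U.prop.le_shift n X (h U hU)⟩
          ext₂' := fun D hD h₁ h₃ => ObjectProperty.le_isoClosure _ _ fun U hU =>
            U.prop.ext_of_isTriangulatedClosed₂ D hD (h₁ U hU) (h₃ U hU) } }

/-- The intersection of two thick subcategories. -/
instance : Min (ThickSubcategory T) where
  min U V :=
    { prop := U.prop ⊓ V.prop
      isStableUnderRetracts :=
        ⟨fun r h => ⟨U.prop.prop_of_retract r h.1, V.prop.prop_of_retract r h.2⟩⟩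
      isTriangulated := inferInstance }

/-- The lattice of thick subcategories: meets are intersections, and the join of a family is
the smallest thick subcategory containing all its members. -/
instance : CompleteLattice (ThickSubcategory T) where
  __ := completeLatticeOfInf (ThickSubcategory T) fun _ =>
    ⟨fun U hU _ hX => hX U hU, fun _ hV X hX _ hU => hV hU X hX⟩
  inf := min
  inf_le_left _ _ _ h := h.1
  inf_le_right _ _ _ h := h.2
  le_inf _ _ _ h₁ h₂ X hX := ⟨h₁ X hX, h₂ X hX⟩

/-- The smallest thick subcategory containing a given class of objects. -/
def closure (P : ObjectProperty T) : ThickSubcategory T :=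
  sInf {U | P ≤ U.prop}

/-- Two thick subcategories `U`, `V` commute if every morphism between an object of `U` and an
object of `V`, in either direction, factors through an object of `U ⊓ V`. -/
def Commute (U V : ThickSubcategory T) : Prop :=
  ∀ ⦃X Y : T⦄ (f : X ⟶ Y), (U.prop X ∧ V.prop Y) ∨ (V.prop X ∧ U.prop Y) →
    ∃ (Z : T) (a : X ⟶ Z) (b : Z ⟶ Y), (U ⊓ V).prop Z ∧ a ≫ b = f

/-- A thick subcategory is central if it commutes with all thick subcategories. -/
def IsCentral (U : ThickSubcategory T) : Prop :=
  ∀ V : ThickSubcategory T, Commute U V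

end Lattice

/-- The centre `Z(Thick T)` of the lattice of thick subcategories, partially ordered by
inclusion. -/
abbrev Centre (T : Type u) [Category.{v} T] [HasZeroObject T] [HasShift T ℤ]
    [Preadditive T] [∀ n : ℤ, (shiftFunctor T n).Additive] [Pretriangulated T] : Type u :=
  {U : ThickSubcategory T // U.IsCentral}

end ThickSubcategory

/-- A map `f` between partially ordered sets is a frame morphism if both orders are frames
(complete lattices in which finite meets distribute over arbitrary joins) and `f` preserves
finite meets (the top element included) and arbitrary joins. The frame structures are
determined by the given orders. -/
def IsFrameMorphism {α β : Type*} [pα : PartialOrder α] [pβ : PartialOrder β] (f : α → β) : Prop :=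
  ∃ (Fα : Order.Frame α) (Fβ : Order.Frame β),
    (∀ a b : α, Fα.le a b ↔ pα.le a b) ∧ (∀ a b : β, Fβ.le a b ↔ pβ.le a b) ∧
      ∃ φ : @FrameHom α β Fα.toCompleteLattice Fβ.toCompleteLattice, ∀ a, φ.toFun a = f a

/-- The Verdier quotient `T / S` of a triangulated category by a triangulated subcategory:
the localization of `T` at the morphisms whose cone is in `S`. -/
abbrev VerdierQuotient {T : Type u} [Category.{v} T] [HasZeroObject T] [HasShift T ℤ]
    [Preadditive T] [∀ n : ℤ, (shiftFunctor T n).Additive] [Pretriangulated T]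
    (S : ObjectProperty T) :=
  S.trW.Localization

/-- The canonical functor `T ⥤ T / S`. -/
abbrev verdierQuotientFunctor {T : Type u} [Category.{v} T] [HasZeroObject T] [HasShift T ℤ]
    [Preadditive T] [∀ n : ℤ, (shiftFunctor T n).Additive] [Pretriangulated T]
    (S : ObjectProperty T) : T ⥤ VerdierQuotient S :=
  S.trW.Q

/-! A morphism factors through an object of a thick subcategory `N` exactly when it vanishes in the
Verdier quotient by `N`. So `U` and `V` commute iff their images modulo `U ⊓ V` are Hom-orthogonal
in both directions. Objects orthogonal to `U` modulo `N ≤ U` form a thick subcategory, so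
commutation passes to joins (`commute_sSup`). An object of `U ⊓ sSup s` has zero identity in the
quotient, which gives distributivity (`inf_sSup_le`) and the frame structure.

Restriction to `S` rests on `exists_retract_of_closure_of_prop`, which replaces objects of a thick
closure by objects of `S` without leaving `U`. For the quotient, thick subcategories of `T / S`
correspond to those of `T` containing `S`, commutation descends along fractions, and meets are
handled by distributivity. -/

namespace ThickSubcategory

open Pretriangulated ZeroObject

/-! ### Inverse images and thick closures. -/

section Functoriality

variable {C : Type*} [Category* C] [HasZeroObject C] [HasShift C ℤ]
  [Preadditive C] [∀ n : ℤ, (shiftFunctor C n).Additive] [Pretriangulated C]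
  {D : Type*} [Category* D] [HasZeroObject D] [HasShift D ℤ]
  [Preadditive D] [∀ n : ℤ, (shiftFunctor D n).Additive] [Pretriangulated D]

/-- The thick subcategory of zero objects. -/
def zero (C : Type*) [Category* C] [HasZeroObject C] [HasShift C ℤ]
    [Preadditive C] [∀ n : ℤ, (shiftFunctor C n).Additive] [Pretriangulated C] :
    ThickSubcategory C where
  prop X := IsZero X
  isStableUnderRetracts := ⟨fun r h => h.of_mono r.i⟩
  isTriangulated :=
    { exists_zero := ⟨_, isZero_zero C, isZero_zero C⟩
      isStableUnderShiftBy := fun n => ⟨fun _ h => (shiftFunctor C n).map_isZero h⟩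
      ext₂' := fun D hD h₁ h₃ => ObjectProperty.le_isoClosure _ _
        (Triangle.isZero₂_of_isZero₁₃ D hD h₁ h₃) }

/-- The inverse image of a thick subcategory under a triangulated functor. -/
def comap (F : C ⥤ D) [F.CommShift ℤ] [F.IsTriangulated] (U : ThickSubcategory D) :
    ThickSubcategory C where
  prop := U.prop.inverseImage F
  isStableUnderRetracts := ⟨fun r h => U.prop.prop_of_retract (r.map F) h⟩
  isTriangulated := inferInstance

lemma le_closure (P : ObjectProperty C) : P ≤ (closure P).prop :=
  fun _ hX _ hU => hU _ hX

lemma closure_le_iff {P : ObjectProperty C} {U : ThickSubcategory C} :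
    closure P ≤ U ↔ P ≤ U.prop :=
  ⟨fun h => (le_closure P).trans h, fun h _ hX => hX U h⟩

end Functoriality

/-! ### Factorizations and vanishing in Verdier quotients. -/

section Quotient

variable {C : Type*} [Category* C] [HasZeroObject C] [HasShift C ℤ]
  [Preadditive C] [∀ n : ℤ, (shiftFunctor C n).Additive] [Pretriangulated C] [IsTriangulated C]
  (P : ObjectProperty C) [P.IsTriangulated]

lemma isZero_Q_obj {Z : C} (hZ : P Z) : IsZero (P.trW.Q.obj Z) := by
  have : P.trW (0 : Z ⟶ 0) := ObjectProperty.trW.mk' P (contractible_distinguished Z) hZ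
  have := Localization.inverts P.trW.Q P.trW _ this
  exact (P.trW.Q.map_isZero (isZero_zero C)).of_iso (asIso (P.trW.Q.map (0 : Z ⟶ 0)))

lemma Q_map_eq_zero_of_fac {X Y Z : C} (a : X ⟶ Z) (b : Z ⟶ Y) (hZ : P Z) :
    P.trW.Q.map (a ≫ b) = 0 := by
  rw [Functor.map_comp, (isZero_Q_obj P hZ).eq_of_tgt (P.trW.Q.map a) 0, zero_comp]

lemma exists_precomp_eq_zero {X Y : C} {f : X ⟶ Y} (hf : P.trW.Q.map f = 0) :
    ∃ (X' : C) (s : X' ⟶ X), P.trW s ∧ s ≫ f = 0 := by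
  obtain ⟨X', s, hs, h⟩ := (MorphismProperty.map_eq_iff_precomp P.trW.Q P.trW f 0).1 (by simpa)
  exact ⟨X', s, hs, by simpa using h⟩

lemma exists_postcomp_eq_zero {X Y : C} {f : X ⟶ Y} (hf : P.trW.Q.map f = 0) :
    ∃ (Y' : C) (s : Y ⟶ Y'), P.trW s ∧ f ≫ s = 0 := by
  obtain ⟨X', s, hs, h⟩ := (MorphismProperty.map_eq_iff_postcomp P.trW.Q P.trW f 0).1 (by simpa)
  exact ⟨X', s, hs, by simpa using h⟩

lemma exists_fac_of_Q_map_eq_zero {X Y : C} {f : X ⟶ Y} (hf : P.trW.Q.map f = 0) :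
    ∃ (Z : C) (a : X ⟶ Z) (b : Z ⟶ Y), P Z ∧ a ≫ b = f := by
  obtain ⟨X', s, ⟨Z, a, c, hT, hZ⟩, h⟩ := exists_precomp_eq_zero P hf
  obtain ⟨b, hb⟩ := Triangle.yoneda_exact₂ _ hT f h
  exact ⟨Z, a, b, hZ, hb.symm⟩

lemma exists_retract_of_isZero_Q_obj {X : C} (hX : IsZero (P.trW.Q.obj X)) :
    ∃ (Z : C), P Z ∧ Nonempty (Retract X Z) := by
  obtain ⟨Z, a, b, hZ, h⟩ := exists_fac_of_Q_map_eq_zero P (f := 𝟙 X) (hX.eq_of_src _ _)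
  exact ⟨Z, hZ, ⟨a, b, h⟩⟩

lemma closure_eq_comap_zero : closure P = comap P.trW.Q (zero _) := by
  apply le_antisymm
  · exact closure_le_iff.2 fun X hX => isZero_Q_obj P hX
  · intro X hX
    obtain ⟨Z, hZ, ⟨r⟩⟩ := exists_retract_of_isZero_Q_obj P hX
    exact (closure P).prop.prop_of_retract r (le_closure P Z hZ)

lemma exists_retract_of_closure {X : C} (hX : (closure P).prop X) :
    ∃ (Z : C), P Z ∧ Nonempty (Retract X Z) := by
  rw [closure_eq_comap_zero] at hX
  exact exists_retract_of_isZero_Q_obj P hX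

variable (U : ThickSubcategory C)

lemma prop_iff_isZero_Q_obj (X : C) : U.prop X ↔ IsZero (U.prop.trW.Q.obj X) := by
  refine ⟨isZero_Q_obj _, fun h => ?_⟩
  obtain ⟨Z, hZ, ⟨r⟩⟩ := exists_retract_of_isZero_Q_obj _ h
  exact U.prop.prop_of_retract r hZ

/-- An object lying both in a thick subcategory `U` and in the thick closure of a triangulated
subcategory `P` is a retract of an object lying in both `U` and `P`. -/
lemma exists_retract_of_closure_of_prop {X : C} (hX : (closure P).prop X) (hU : U.prop X) :
    ∃ (Z : C), P Z ∧ U.prop Z ∧ Nonempty (Retract X Z) := by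
  obtain ⟨Y, hY, ⟨r⟩⟩ := exists_retract_of_closure P hX
  -- The idempotent `r.r ≫ r.i` factors through `X`, hence vanishes modulo `U`. Its complement
  -- becomes the identity there, so the cone `Z` lies in `U`. As `r.r` kills the complement, it
  -- extends over `Z`, which exhibits `X` as a retract of `Z`.
  obtain ⟨Z, hZ, b, c, hT⟩ := P.distinguished_cocone_triangle (𝟙 Y - r.r ≫ r.i) hY hY
  have h : (𝟙 Y - r.r ≫ r.i) ≫ r.r = 0 := by simp [Preadditive.sub_comp]
  obtain ⟨q, hq⟩ : ∃ q : Z ⟶ X, r.r = b ≫ q := Triangle.yoneda_exact₂ _ hT r.r h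
  refine ⟨Z, hZ, ?_, ⟨r.i ≫ b, q, ?_⟩⟩
  · have : IsIso (U.prop.trW.Q.map (𝟙 Y - r.r ≫ r.i)) := by
      rw [Functor.map_sub, Q_map_eq_zero_of_fac U.prop _ _ hU, sub_zero]
      infer_instance
    rw [prop_iff_isZero_Q_obj]
    exact Triangle.isZero₃_of_isIso₁ _ (U.prop.trW.Q.map_distinguished _ hT) this
  · rw [Category.assoc, ← hq, r.retract]

end Quotient

/-! ### Commutation, orthogonals and distributivity. -/

section Commute

variable {C : Type*} [Category* C] [HasZeroObject C] [HasShift C ℤ]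
  [Preadditive C] [∀ n : ℤ, (shiftFunctor C n).Additive] [Pretriangulated C]

lemma Commute.symm {U V : ThickSubcategory C} (h : Commute U V) : Commute V U := by
  intro X Y f hf
  rw [inf_comm]
  exact h f hf.symm

lemma commute_of_le {U V : ThickSubcategory C} (h : U ≤ V) : Commute U V := by
  have : U ⊓ V = U := inf_eq_left.2 h
  intro X Y f hf
  rw [this]
  rcases hf with ⟨hX, -⟩ | ⟨-, hY⟩
  · exact ⟨X, 𝟙 X, f, hX, Category.id_comp f⟩
  · exact ⟨Y, f, 𝟙 Y, hY, Category.comp_id f⟩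

lemma isCentral_top : (⊤ : ThickSubcategory C).IsCentral :=
  fun _ => (commute_of_le le_top).symm

/-- Factor first through `U ⊓ W`, then apply centrality of `V` against `U ⊓ W` rather than `W`, so
that the second factorization stays in `U`. -/
lemma IsCentral.inf {U V : ThickSubcategory C} (hU : U.IsCentral) (hV : V.IsCentral) :
    (U ⊓ V).IsCentral := by
  intro W X Y f hf
  rcases hf with ⟨⟨hX₁, hX₂⟩, hY⟩ | ⟨hX, ⟨hY₁, hY₂⟩⟩
  · obtain ⟨Z, a, b, hZ, rfl⟩ := hU W f (Or.inl ⟨hX₁, hY⟩)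
    obtain ⟨Z', a', b', hZ', rfl⟩ := hV (U ⊓ W) a (Or.inl ⟨hX₂, hZ⟩)
    exact ⟨Z', a', b' ≫ b, ⟨⟨hZ'.2.1, hZ'.1⟩, hZ'.2.2⟩, by simp⟩
  · obtain ⟨Z, a, b, hZ, rfl⟩ := hU W f (Or.inr ⟨hX, hY₁⟩)
    obtain ⟨Z', a', b', hZ', rfl⟩ := hV (U ⊓ W) b (Or.inr ⟨hZ, hY₂⟩)
    exact ⟨Z', a ≫ a', b', ⟨⟨hZ'.2.1, hZ'.1⟩, hZ'.2.2⟩, by simp⟩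

variable [IsTriangulated C] {U N : ThickSubcategory C}

/-- The objects `Y` such that every morphism from `U` to `Y` factors through `N ≤ U`. -/
def rightOrthogonal (hN : N ≤ U) : ThickSubcategory C where
  prop Y := ∀ ⦃X : C⦄ (f : X ⟶ Y), U.prop X → N.prop.trW.Q.map f = 0
  isStableUnderRetracts := ⟨fun {Y Y'} r h X f hX => by
    have := h (f ≫ r.i) hX
    rw [← Category.comp_id f, ← r.retract, ← Category.assoc, Functor.map_comp, this, zero_comp]⟩
  isTriangulated :=
    { exists_zero := ⟨0, isZero_zero C, fun X f _ => by
        rw [(isZero_zero C).eq_of_tgt f 0, Functor.map_zero]⟩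
      isStableUnderShiftBy := fun n => ⟨fun Y h X f hX => by
        obtain ⟨g, hg⟩ : ∃ g, (shiftEquiv C n).symm.toAdjunction.homEquiv X Y g = f :=
          ((shiftEquiv C n).symm.toAdjunction.homEquiv X Y).surjective f
        obtain ⟨Z, a, b, hZ, hab⟩ := exists_fac_of_Q_map_eq_zero N.prop
          (h g (U.prop.le_shift (-n) X hX))
        rw [← hg, ← hab, Adjunction.homEquiv_naturality_right]
        exact Q_map_eq_zero_of_fac _ _ _ (N.prop.le_shift n Z hZ)⟩
      ext₂' := fun T hT h₁ h₃ => ObjectProperty.le_isoClosure _ _ fun X f hX => by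
        -- Precomposing with `s`, invertible modulo `N`, makes `f` lift to the first vertex. The new
        -- source stays in `U` because the cone of `s` lies in `N ≤ U`.
        obtain ⟨X', s, hs, hsf⟩ := exists_precomp_eq_zero N.prop (h₃ (f ≫ T.mor₂) hX)
        have := Localization.inverts N.prop.trW.Q N.prop.trW _ hs
        obtain ⟨g, hg⟩ := Triangle.coyoneda_exact₂ T hT (s ≫ f) (by simpa using hsf)
        obtain ⟨Z, a, c, hT', hZ⟩ := hs
        have hX' : U.prop X' := U.prop.ext_of_isTriangulatedClosed₁ _ hT' hX (hN _ hZ)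
        rw [← cancel_epi (N.prop.trW.Q.map s), ← Functor.map_comp, hg, Functor.map_comp,
          h₁ g hX', zero_comp, comp_zero] }

/-- The objects `X` such that every morphism from `X` to `U` factors through `N ≤ U`. -/
def leftOrthogonal (hN : N ≤ U) : ThickSubcategory C where
  prop X := ∀ ⦃Y : C⦄ (f : X ⟶ Y), U.prop Y → N.prop.trW.Q.map f = 0
  isStableUnderRetracts := ⟨fun {X X'} r h Y f hY => by
    have := h (r.r ≫ f) hY
    rw [← Category.id_comp f, ← r.retract, Category.assoc, Functor.map_comp, this, comp_zero]⟩
  isTriangulated :=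
    { exists_zero := ⟨0, isZero_zero C, fun X f _ => by
        rw [(isZero_zero C).eq_of_src f 0, Functor.map_zero]⟩
      isStableUnderShiftBy := fun n => ⟨fun X h Y f hY => by
        obtain ⟨g, hg⟩ : ∃ g, ((shiftEquiv C n).toAdjunction.homEquiv X Y).symm g = f :=
          ((shiftEquiv C n).toAdjunction.homEquiv X Y).symm.surjective f
        obtain ⟨Z, a, b, hZ, hab⟩ := exists_fac_of_Q_map_eq_zero N.prop
          (h g (U.prop.le_shift (-n) Y hY))
        rw [← hg, ← hab, Adjunction.homEquiv_naturality_left_symm]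
        exact Q_map_eq_zero_of_fac _ _ _ (N.prop.le_shift n Z hZ)⟩
      ext₂' := fun T hT h₁ h₃ => ObjectProperty.le_isoClosure _ _ fun Y f hY => by
        obtain ⟨Y', s, hs, hsf⟩ := exists_postcomp_eq_zero N.prop (h₁ (T.mor₁ ≫ f) hY)
        have := Localization.inverts N.prop.trW.Q N.prop.trW _ hs
        obtain ⟨g, hg⟩ := Triangle.yoneda_exact₂ T hT (f ≫ s) (by simpa using hsf)
        obtain ⟨Z, a, c, hT', hZ⟩ := hs
        have hY' : U.prop Y' := U.prop.ext_of_isTriangulatedClosed₂ _ hT' hY (hN _ hZ)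
        rw [← cancel_mono (N.prop.trW.Q.map s), ← Functor.map_comp, hg, Functor.map_comp,
          h₃ g hY', comp_zero, zero_comp] }

/-- Each member of the family is orthogonal to `U` modulo `N`, since morphisms factor through `U ⊓ V
≤ N`; thickness of the orthogonals then absorbs the join. -/
lemma sSup_le_orthogonal (hN : N ≤ U) {s : Set (ThickSubcategory C)}
    (hs : ∀ V ∈ s, Commute U V) (hsN : ∀ V ∈ s, U ⊓ V ≤ N) :
    sSup s ≤ rightOrthogonal hN ⊓ leftOrthogonal hN := by
  refine sSup_le fun V hV X hX => ⟨fun Y f hY => ?_, fun Y f hY => ?_⟩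
  · obtain ⟨Z, a, b, hZ, rfl⟩ := hs V hV f (Or.inl ⟨hY, hX⟩)
    exact Q_map_eq_zero_of_fac _ _ _ (hsN V hV Z hZ)
  · obtain ⟨Z, a, b, hZ, rfl⟩ := hs V hV f (Or.inr ⟨hX, hY⟩)
    exact Q_map_eq_zero_of_fac _ _ _ (hsN V hV Z hZ)

/-- A thick subcategory commuting with the members of a family distributes over its join. -/
lemma inf_sSup_le {s : Set (ThickSubcategory C)}
    (hs : ∀ V ∈ s, Commute U V) (hsN : ∀ V ∈ s, U ⊓ V ≤ N) : U ⊓ sSup s ≤ N := by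
  intro X hX
  -- The orthogonals are only available modulo a subcategory of `U`, so `N` is replaced by `U ⊓ N`.
  have h := sSup_le_orthogonal (N := U ⊓ N) inf_le_left hs
    (fun V hV => le_inf inf_le_left (hsN V hV)) X hX.2
  refine ((prop_iff_isZero_Q_obj (U ⊓ N) X).2 ?_).2
  rw [IsZero.iff_id_eq_zero]
  exact ((U ⊓ N).prop.trW.Q.map_id X).symm.trans (h.1 (𝟙 X) hX.1)

lemma commute_sSup {s : Set (ThickSubcategory C)} (hs : ∀ V ∈ s, Commute U V) :
    Commute U (sSup s) := by
  have h := sSup_le_orthogonal (N := U ⊓ sSup s) inf_le_left hs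
    (fun V hV => inf_le_inf_left U (le_sSup hV))
  rintro X Y f (⟨hX, hY⟩ | ⟨hX, hY⟩)
  · exact exists_fac_of_Q_map_eq_zero _ ((h Y hY).1 f hX)
  · exact exists_fac_of_Q_map_eq_zero _ ((h X hX).2 f hY)

lemma inf_sup_le {V W : ThickSubcategory C} (hV : Commute U V) (hW : Commute U W)
    (h₁ : U ⊓ V ≤ N) (h₂ : U ⊓ W ≤ N) : U ⊓ (V ⊔ W) ≤ N := by
  rw [← sSup_pair]
  exact inf_sSup_le (by rintro _ (rfl | rfl) <;> assumption)
    (by rintro _ (rfl | rfl) <;> assumption)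

lemma commute_sup {V W : ThickSubcategory C} (hV : Commute U V) (hW : Commute U W) :
    Commute U (V ⊔ W) := by
  rw [← sSup_pair]
  exact commute_sSup (by rintro _ (rfl | rfl) <;> assumption)

lemma isCentral_sSup {s : Set (ThickSubcategory C)} (hs : ∀ V ∈ s, V.IsCentral) :
    (sSup s).IsCentral :=
  fun U => (commute_sSup fun V hV => (hs V hV U).symm).symm

end Commute

/-! ### The frame of central thick subcategories. -/

namespace Centre

variable {C : Type u} [Category.{v} C] [HasZeroObject C] [HasShift C ℤ]
  [Preadditive C] [∀ n : ℤ, (shiftFunctor C n).Additive] [Pretriangulated C] [IsTriangulated C]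

instance : SupSet (Centre C) where
  sSup s := ⟨sSup (Subtype.val '' s), isCentral_sSup (by rintro _ ⟨U, -, rfl⟩; exact U.2)⟩

/-- Joins, binary meets and the top are those of all thick subcategories; infinite meets are
obtained from joins and need not be intersections. -/
instance : CompleteLattice (Centre C) where
  __ := completeLatticeOfSup (Centre C) fun s =>
    ⟨fun U hU => le_sSup (α := ThickSubcategory C) (Set.mem_image_of_mem _ hU),
      fun V hV => sSup_le (α := ThickSubcategory C) (by rintro _ ⟨U, hU, rfl⟩; exact hV hU)⟩
  inf U V := ⟨U.1 ⊓ V.1, U.2.inf V.2⟩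
  inf_le_left U V := inf_le_left (a := U.1)
  inf_le_right U V := inf_le_right (a := U.1)
  le_inf U V W h₁ h₂ := le_inf (α := ThickSubcategory C) h₁ h₂
  top := ⟨⊤, isCentral_top⟩
  le_top U := le_top (a := U.1)

instance : Order.Frame (Centre C) :=
  Order.Frame.ofMinimalAxioms
    { inf_sSup_le_iSup_inf := fun U s =>
        inf_sSup_le (U := U.1) (fun V _ => U.2 V) (by
          rintro _ ⟨V, hV, rfl⟩
          exact le_iSup₂_of_le (f := fun V (_ : V ∈ s) => U ⊓ V) V hV le_rfl) }

end Centre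

end ThickSubcategory

/-- A map between frames preserving the top element, binary meets and arbitrary joins is a
frame morphism. -/
lemma IsFrameMorphism.of_map {α β : Type*} [Order.Frame α] [Order.Frame β] (f : α → β)
    (h_top : f ⊤ = ⊤) (h_inf : ∀ a b, f (a ⊓ b) = f a ⊓ f b)
    (h_sSup : ∀ s, f (sSup s) ≤ sSup (f '' s)) : IsFrameMorphism f := by
  have hf : Monotone f := fun a b h => by
    rw [← inf_eq_left, ← h_inf, inf_eq_left.2 h]
  exact ⟨inferInstance, inferInstance, fun _ _ => Iff.rfl, fun _ _ => Iff.rfl,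
    { toFun := f
      map_inf' := h_inf
      map_top' := h_top
      map_sSup' := fun s => le_antisymm (h_sSup s)
        (sSup_le (by rintro _ ⟨a, ha, rfl⟩; exact hf (le_sSup ha))) }, fun _ => rfl⟩

namespace ThickSubcategory

open Pretriangulated ZeroObject

/-! ### Restriction to a triangulated subcategory. -/

section Restriction

variable {C : Type*} [Category* C] [HasZeroObject C] [HasShift C ℤ]
  [Preadditive C] [∀ n : ℤ, (shiftFunctor C n).Additive] [Pretriangulated C] [IsTriangulated C]
  {S : ObjectProperty C} [S.IsTriangulated]

/-- The thick closure in the ambient category of a thick subcategory of `S`. -/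
def extend (V : ThickSubcategory S.FullSubcategory) : ThickSubcategory C :=
  closure (V.prop.map S.ι)

lemma exists_retract_of_extend {V : ThickSubcategory S.FullSubcategory} {U : ThickSubcategory C}
    {X : C} (hX : V.extend.prop X) (hU : U.prop X) :
    ∃ (Z : S.FullSubcategory), V.prop Z ∧ U.prop Z.obj ∧ Nonempty (Retract X Z.obj) := by
  obtain ⟨Z, ⟨Z', hZ', ⟨e⟩⟩, hZ, ⟨r⟩⟩ := exists_retract_of_closure_of_prop _ U hX hU
  exact ⟨Z', hZ', U.prop.prop_of_iso e.symm hZ, ⟨r.trans e.symm.retract⟩⟩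

omit [IsTriangulated C] in
lemma prop_extend (V : ThickSubcategory S.FullSubcategory) {X : S.FullSubcategory}
    (hX : V.prop X) : V.extend.prop X.obj :=
  le_closure _ _ (V.prop.prop_map_obj S.ι hX)

lemma comap_ι_extend_le (V : ThickSubcategory S.FullSubcategory) :
    comap S.ι V.extend ≤ V := by
  intro X hX
  -- The top element is the intersection of the empty family, so membership in it is vacuous.
  obtain ⟨Z, hZ, -, ⟨r⟩⟩ := exists_retract_of_extend (U := ⊤) hX (fun U hU => hU.elim)
  exact V.prop.prop_of_retract
    ⟨ObjectProperty.homMk r.i, ObjectProperty.homMk r.r, by ext; exact r.retract⟩ hZ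

/-- Centrality of `U` against `V.extend` gives a factorization in the ambient category; its middle
object is a retract of an object of `V` lying in `U`, which moves the factorization into `S`. -/
lemma IsCentral.comap_ι {U : ThickSubcategory C} (hU : U.IsCentral) :
    (comap S.ι U).IsCentral := by
  intro V X Y f hf
  obtain ⟨Z, a, b, hZ, hab⟩ := hU V.extend f.hom
    (hf.imp (fun h => ⟨h.1, prop_extend V h.2⟩) (fun h => ⟨prop_extend V h.1, h.2⟩))
  obtain ⟨Z', hVZ', hUZ', ⟨r⟩⟩ := exists_retract_of_extend hZ.2 hZ.1
  exact ⟨Z', ObjectProperty.homMk (a ≫ r.i), ObjectProperty.homMk (r.r ≫ b), ⟨hUZ', hVZ'⟩, by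
    ext; simp [← hab]⟩

lemma comap_ι_sSup_le {s : Set (ThickSubcategory C)} (hs : ∀ U ∈ s, U.IsCentral)
    {V : ThickSubcategory S.FullSubcategory} (hV : ∀ U ∈ s, comap S.ι U ≤ V) :
    comap S.ι (sSup s) ≤ V := by
  -- Distributivity needs a thick subcategory, so it is applied to `closure S` in place of `S`.
  have : closure S ⊓ sSup s ≤ V.extend :=
    inf_sSup_le (fun U hU => (hs U hU _).symm) fun U hU X hX => by
      obtain ⟨Z, hZ, hUZ, ⟨r⟩⟩ := exists_retract_of_closure_of_prop S U hX.1 hX.2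
      exact V.extend.prop.prop_of_retract r (prop_extend V (X := ⟨Z, hZ⟩) (hV U hU _ hUZ))
  exact fun X hX => comap_ι_extend_le V X (this _ ⟨le_closure _ _ X.2, hX⟩)

end Restriction

/-! ### Passage to the Verdier quotient. -/

section Quotient

variable {C : Type*} [Category* C] [HasZeroObject C] [HasShift C ℤ]
  [Preadditive C] [∀ n : ℤ, (shiftFunctor C n).Additive] [Pretriangulated C] [IsTriangulated C]
  {S : ObjectProperty C} [S.IsTriangulated]

-- As `S ≤ W`, the quotient functor of `W` factors through the localization at `S.trW`, so
-- membership in `W` is detected there.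
omit [S.IsTriangulated] in
lemma prop_of_retract_Q_obj {W : ThickSubcategory C} (hW : S ≤ W.prop) {X Y : C}
    (r : Retract (S.trW.Q.obj X) (S.trW.Q.obj Y)) (hY : W.prop Y) : W.prop X := by
  have hW' : S.trW.IsInvertedBy W.prop.trW.Q := fun _ _ f hf =>
    Localization.inverts W.prop.trW.Q W.prop.trW f (ObjectProperty.trW_monotone hW _ hf)
  let G := Localization.lift W.prop.trW.Q hW' S.trW.Q
  let e : S.trW.Q ⋙ G ≅ W.prop.trW.Q := Localization.fac _ _ _
  rw [prop_iff_isZero_Q_obj] at hY ⊢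
  exact (zero _).prop.prop_of_retract
    ((e.app X).symm.retract.trans ((r.map G).trans (e.app Y).retract)) hY

/-- The image in the quotient by `S` of a thick subcategory containing `S`. -/
def quotient (W : ThickSubcategory C) (hW : S ≤ W.prop) :
    ThickSubcategory (VerdierQuotient S) where
  prop := W.prop.map (verdierQuotientFunctor S)
  isStableUnderRetracts := ⟨fun {X Y} r ⟨Y', hY', ⟨e⟩⟩ => by
    have : S.trW.Q.EssSurj := Localization.essSurj S.trW.Q S.trW
    let e' := S.trW.Q.objObjPreimageIso X
    exact ⟨_, prop_of_retract_Q_obj hW (e'.retract.trans (r.trans e.symm.retract)) hY', ⟨e'⟩⟩⟩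
  isTriangulated :=
    { exists_zero := ⟨S.trW.Q.obj 0, S.trW.Q.map_isZero (isZero_zero C),
        W.prop.prop_map_obj _ W.prop.prop_zero⟩
      isStableUnderShiftBy := fun n => ⟨fun X ⟨X', hX', ⟨e⟩⟩ =>
        ⟨X'⟦n⟧, W.prop.le_shift n X' hX',
          ⟨(S.trW.Q.commShiftIso n).app X' ≪≫ (shiftFunctor _ n).mapIso e⟩⟩⟩
      ext₂' := fun T ⟨T', e, hT'⟩ ⟨X₁, h₁, ⟨e₁⟩⟩ ⟨X₃, h₃, ⟨e₃⟩⟩ =>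
        ObjectProperty.le_isoClosure _ _
          ⟨T'.obj₂, W.prop.ext_of_isTriangulatedClosed₂ T' hT'
            (prop_of_retract_Q_obj hW (e₁ ≪≫ Triangle.π₁.mapIso e).symm.retract h₁)
            (prop_of_retract_Q_obj hW (e₃ ≪≫ Triangle.π₃.mapIso e).symm.retract h₃),
            ⟨(Triangle.π₂.mapIso e).symm⟩⟩ }

variable {W W' : ThickSubcategory C} (hW : S ≤ W.prop) (hW' : S ≤ W'.prop)

lemma quotient_prop_Q_obj_iff {X : C} : (W.quotient hW).prop (S.trW.Q.obj X) ↔ W.prop X :=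
  ⟨fun ⟨_, hY, ⟨e⟩⟩ => prop_of_retract_Q_obj hW e.symm.retract hY,
    fun hX => W.prop.prop_map_obj _ hX⟩

lemma le_comap_Q_prop (V : ThickSubcategory (VerdierQuotient S)) :
    S ≤ (comap S.trW.Q V).prop :=
  fun _ hX => V.prop.prop_of_iso (isZero_Q_obj S hX).isoZero.symm V.prop.prop_zero

lemma quotient_le_iff {V : ThickSubcategory (VerdierQuotient S)} :
    W.quotient hW ≤ V ↔ W ≤ comap S.trW.Q V :=
  ⟨fun h _ hX => h _ (W.prop.prop_map_obj _ hX),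
    fun h _ ⟨X, hX, ⟨e⟩⟩ => V.prop.prop_of_iso e (h X hX)⟩

lemma quotient_comap_Q (V : ThickSubcategory (VerdierQuotient S)) :
    (comap S.trW.Q V).quotient (le_comap_Q_prop V) = V := by
  have : S.trW.Q.EssSurj := Localization.essSurj S.trW.Q S.trW
  refine le_antisymm ((quotient_le_iff _).2 le_rfl) fun X hX => ?_
  let e := S.trW.Q.objObjPreimageIso X
  exact ⟨_, V.prop.prop_of_iso e.symm hX, ⟨e⟩⟩

lemma quotient_inf :
    (W ⊓ W').quotient (le_inf hW hW') = W.quotient hW ⊓ W'.quotient hW' := by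
  refine le_antisymm (fun _ ⟨X, hX, he⟩ => ⟨⟨X, hX.1, he⟩, ⟨X, hX.2, he⟩⟩) ?_
  rintro X ⟨⟨Y, hY, ⟨e⟩⟩, h⟩
  exact ⟨Y, ⟨hY, (quotient_prop_Q_obj_iff hW').1
    ((W'.quotient hW').prop.prop_of_iso e.symm h)⟩, ⟨e⟩⟩

/-- Write a morphism as a right fraction. The apex is isomorphic in the quotient to the source,
hence lies in the same subcategory, and the numerator factors by hypothesis. -/
lemma Commute.quotient (h : Commute W W') :
    Commute (W.quotient hW) (W'.quotient hW') := by
  have key : ∀ {X Y : C} (f : S.trW.Q.obj X ⟶ S.trW.Q.obj Y),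
      (W.prop X ∧ W'.prop Y) ∨ (W'.prop X ∧ W.prop Y) →
      ∃ (Z : C) (a : S.trW.Q.obj X ⟶ S.trW.Q.obj Z) (b : S.trW.Q.obj Z ⟶ S.trW.Q.obj Y),
        (W ⊓ W').prop Z ∧ a ≫ b = f := by
    intro X Y f hf
    obtain ⟨φ, rfl⟩ := Localization.exists_rightFraction S.trW.Q S.trW f
    let i := Localization.isoOfHom S.trW.Q S.trW φ.s φ.hs
    obtain ⟨Z, a, b, hZ, hab⟩ := h φ.f (hf.imp
      (fun h => ⟨prop_of_retract_Q_obj hW i.retract h.1, h.2⟩)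
      (fun h => ⟨prop_of_retract_Q_obj hW' i.retract h.1, h.2⟩))
    refine ⟨Z, i.inv ≫ S.trW.Q.map a, S.trW.Q.map b, hZ, ?_⟩
    rw [Category.assoc, ← Functor.map_comp, hab, Iso.inv_comp_eq]
    exact (φ.map_s_comp_map S.trW.Q (Localization.inverts _ _)).symm
  intro X Y f hf
  rw [← quotient_inf]
  rcases hf with ⟨⟨X', hX, ⟨e⟩⟩, ⟨Y', hY, ⟨e'⟩⟩⟩ | ⟨⟨X', hX, ⟨e⟩⟩, ⟨Y', hY, ⟨e'⟩⟩⟩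
  · obtain ⟨Z, a, b, hZ, hab⟩ := key (e.hom ≫ f ≫ e'.inv) (Or.inl ⟨hX, hY⟩)
    exact ⟨_, e.inv ≫ a, b ≫ e'.hom, ObjectProperty.prop_map_obj _ _ hZ, by
      simp [reassoc_of% hab]⟩
  · obtain ⟨Z, a, b, hZ, hab⟩ := key (e.hom ≫ f ≫ e'.inv) (Or.inr ⟨hX, hY⟩)
    exact ⟨_, e.inv ≫ a, b ≫ e'.hom, ObjectProperty.prop_map_obj _ _ hZ, by
      simp [reassoc_of% hab]⟩

variable (S) in
/-- The thick subcategory `(U ⊔ S) / S` of the quotient by `S`. -/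
def joinQuotient (U : ThickSubcategory C) : ThickSubcategory (VerdierQuotient S) :=
  (U ⊔ closure S).quotient (closure_le_iff.1 le_sup_right)

/-- This adjunction with the inverse image is what makes `joinQuotient S` preserve joins. -/
lemma joinQuotient_le_iff {U : ThickSubcategory C} {V : ThickSubcategory (VerdierQuotient S)} :
    joinQuotient S U ≤ V ↔ U ≤ comap S.trW.Q V := by
  rw [joinQuotient, quotient_le_iff, sup_le_iff,
    and_iff_left (closure_le_iff.2 (le_comap_Q_prop V))]

lemma IsCentral.joinQuotient {U : ThickSubcategory C} (hU : U.IsCentral) :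
    (joinQuotient S U).IsCentral := by
  intro V
  rw [← quotient_comap_Q V]
  exact Commute.quotient _ _ (commute_sup (hU _).symm
    (commute_of_le (closure_le_iff.2 (le_comap_Q_prop V))).symm).symm

lemma joinQuotient_top : joinQuotient S (⊤ : ThickSubcategory C) = ⊤ :=
  top_le_iff.1 ((quotient_comap_Q ⊤).symm.trans_le
    ((quotient_le_iff _).2 (le_top.trans (joinQuotient_le_iff.1 le_rfl))))

lemma IsCentral.inf_sup_closure {U : ThickSubcategory C} (hU : U.IsCentral)
    (V : ThickSubcategory C) (P : ObjectProperty C) :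
    (U ⊓ V) ⊔ closure P = (U ⊔ closure P) ⊓ (V ⊔ closure P) := by
  refine le_antisymm (le_inf (sup_le_sup_right inf_le_left _)
    (sup_le_sup_right inf_le_right _)) ?_
  rw [inf_comm (U ⊔ closure P)]
  -- Distribute twice: `V ⊔ closure P` over `U ⊔ closure P`, then `U` over `V ⊔ closure P`.
  -- Centrality of `U` suffices, since `closure P` is contained in `V ⊔ closure P`.
  refine inf_sup_le (hU _).symm (commute_of_le le_sup_right).symm ?_
    (inf_le_right.trans le_sup_right)
  rw [inf_comm]
  exact inf_sup_le (hU _) (hU _) le_sup_left (inf_le_right.trans le_sup_right)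

lemma IsCentral.joinQuotient_inf {U : ThickSubcategory C} (hU : U.IsCentral)
    (V : ThickSubcategory C) :
    ThickSubcategory.joinQuotient S (U ⊓ V) =
      ThickSubcategory.joinQuotient S U ⊓ ThickSubcategory.joinQuotient S V := by
  simp only [ThickSubcategory.joinQuotient, ← quotient_inf, hU.inf_sup_closure V]

end Quotient

end ThickSubcategory

theorem mainTheorem5 (T : Type u) [Category.{v} T] [HasZeroObject T] [HasShift T ℤ]
    [Preadditive T] [∀ n : ℤ, (shiftFunctor T n).Additive] [Pretriangulated T]
    [IsTriangulated T] [EssentiallySmall.{w} T]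
    (S : ObjectProperty T) [S.IsTriangulated] :
    (∃ f : ThickSubcategory.Centre T → ThickSubcategory.Centre S.FullSubcategory,
      IsFrameMorphism f ∧
        ∀ U : ThickSubcategory.Centre T,
          (f U).1.prop = U.1.prop.inverseImage S.ι) ∧
    (∃ g : ThickSubcategory.Centre T → ThickSubcategory.Centre (VerdierQuotient S),
      IsFrameMorphism g ∧
        ∀ U : ThickSubcategory.Centre T,
          (g U).1.prop =
            (U.1 ⊔ ThickSubcategory.closure S).prop.map (verdierQuotientFunctor S)) := by
  constructor
  · refine ⟨fun U => ⟨ThickSubcategory.comap S.ι U.1, U.2.comap_ι⟩,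
      IsFrameMorphism.of_map _ ?_ (fun U V => rfl) (fun s => ?_), fun U => rfl⟩
    · exact top_le_iff.1 fun X _ U hU => hU.elim
    · refine ThickSubcategory.comap_ι_sSup_le (by rintro _ ⟨U, -, rfl⟩; exact U.2) ?_
      rintro _ ⟨U, hU, rfl⟩
      exact le_sSup (α := ThickSubcategory S.FullSubcategory) ⟨_, ⟨U, hU, rfl⟩, rfl⟩
  · refine ⟨fun U => ⟨ThickSubcategory.joinQuotient S U.1, U.2.joinQuotient⟩,
      IsFrameMorphism.of_map _ ?_ (fun U V => ?_) (fun s => ?_), fun U => rfl⟩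
    · exact Subtype.ext ThickSubcategory.joinQuotient_top
    · exact Subtype.ext (U.2.joinQuotient_inf V.1)
    · refine ThickSubcategory.joinQuotient_le_iff.2 (sSup_le ?_)
      rintro _ ⟨U, hU, rfl⟩
      exact ThickSubcategory.joinQuotient_le_iff.1
        (le_sSup (α := ThickSubcategory (VerdierQuotient S)) ⟨_, ⟨U, hU, rfl⟩, rfl⟩)
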